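/- Let $\mathbb K$ be a field of characteristic zero. Let $E$ be a $\mathbb K$-linear representation of $S_2$, let $\mathcal F(E)$ be the free (symmetric, $\mathbb K$-linear) operad on $E$ placed in arity $2$, let $R\subseteq\mathcal F(E)(3)$ be an $S_3$-stable subspace, and let $\mathcal P=\mathcal F(E)/(R)$ be the corresponding binary quadratic operad. Let $p$ be an even and $q$ an odd integer; the elements of $E$ are regarded as operations of degree $p$, so that $\mathcal P(n)$ lies in degree $p(n-1)$ (the basic case is $p=0$, $q=1$). A $\mathcal P$-algebra on a $\mathbb Z$-graded vector space $V$ is an operad morphism $\mathcal P\to \mathrm{End}(V)$, $\mathrm{End}(V)(n)=\mathrm{Hom}(V^{\otimes n},V)$, with the Koszul sign convention. Let $(A,d)$ be a dg $\mathcal P$-algebra: a $\mathcal P$-algebra with a linear map $d:A\to A$ of degree $q$ such that $d^2=0$ and $d$ is a graded derivation of all operations. For $e\in E$ write $[x,y]_e$ for the corresponding multiplication on $A$. Let $sA$ be the suspension of $A$, $(sA)_k=s(A_{k-1})$, and define, for homogeneous $x,y \in A$, the derived brackets on $sA$ by $$[sx,sy]_{d,e}:=-(-1)^{|x|}\,s[dx,y]_e,\qquad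 [sx,sy]^{d}_{e}:=s[x,dy]_e .$$ Let $A'\subseteq A$ be a graded subspace which is a trivial subalgebra, that is, $[x,y]_e=0$ for all $x,y\in A'$ and $e\in E$; it is not assumed that $dA'\subseteq A'$. Suppose that $sA'$ is closed under the derived brackets $[\cdot,\cdot]_{d,e}$ and $[\cdot,\cdot]^d_e$ for all $e\in E$. Then $sA'$ is a $\mathcal P$-algebra with respect to the derived brackets: on $sA'$ one has $[\cdot,\cdot]_{d,e}=[\cdot,\cdot]^{d}_{e}$ for every $e\in E$, and there is a $\mathcal P$-algebra structure on the graded space $sA'$ (with the elements of $E$ acting in degree $p+q-1$, which is degree $0$ in the basic case) in which every $e\in E$ acts by this common bracket. -/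

import Mathlib

universe u v w

/-! ### Combinatorics of grafting

Slots and leaves are numbered from `0`. Grafting an `n`-ary operation into slot `i` of an `m`-ary
one gives an operation with `r` leaves, where `r + 1 = m + n`. -/

/-- The leaves of the grafted operation: either a slot `a ≠ i` of the outer operation, or a slot of
the inner one. The inner slots occupy the consecutive places `i, …, i + n - 1`. -/
def graftEquiv {m n r : ℕ} (h : r + 1 = m + n) (i : Fin m) :
    Fin r ≃ {a : Fin m // a ≠ i} ⊕ Fin n where
  toFun k :=
    if h₁ : (k : ℕ) < i then
      Sum.inl ⟨⟨k, by omega⟩, fun e => by have := congrArg Fin.val e; simp at this; omega⟩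
    else if h₂ : (k : ℕ) < i + n then Sum.inr ⟨k - i, by omega⟩
    else Sum.inl ⟨⟨k + 1 - n, by omega⟩, fun e => by
      have := congrArg Fin.val e; simp at this; omega⟩
  invFun := Sum.elim
    (fun a => if h₁ : (a.1 : ℕ) < i then ⟨a.1, by omega⟩ else
      ⟨a.1 + n - 1, by
        have h₂ : (a.1 : ℕ) ≠ i := fun e => a.2 (Fin.ext e)
        omega⟩)
    (fun l => ⟨i + l, by omega⟩)
  left_inv k := by
    dsimp only
    split_ifs with h₁ h₂
    · simp only [Sum.elim_inl, dif_pos h₁]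
    · simp only [Sum.elim_inr, Fin.ext_iff]; omega
    · have h₃ : ¬ ((k : ℕ) + 1 - n < i) := by omega
      simp only [Sum.elim_inl, dif_neg h₃, Fin.ext_iff]; omega
  right_inv s := by
    rcases s with ⟨a, ha⟩ | l
    · have h₂ : (a : ℕ) ≠ i := fun e => ha (Fin.ext e)
      by_cases h₁ : (a : ℕ) < i
      · simp only [Sum.elim_inl, dif_pos h₁]
      · have h₃ : ¬ ((a : ℕ) + n - 1 < i) := by omega
        have h₄ : ¬ ((a : ℕ) + n - 1 < i + n) := by omega
        simp only [Sum.elim_inl, dif_neg h₁, dif_neg h₃, dif_neg h₄, Sum.inl.injEq,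
          Subtype.mk.injEq, Fin.ext_iff]
        omega
    · simp

/-- The permutation `σ ∘ᵢ τ` of the `m + n - 1` leaves: it moves the block inserted at slot `i` to
slot `σ i`, permutes the other slots by `σ`, and permutes inside the block by `τ`. -/
def graftPerm {m n r : ℕ} (h : r + 1 = m + n) (i : Fin m)
    (σ : Equiv.Perm (Fin m)) (τ : Equiv.Perm (Fin n)) : Equiv.Perm (Fin r) :=
  (graftEquiv h i).trans
    ((Equiv.sumCongr
      (σ.subtypeEquiv (p := fun a => a ≠ i) (q := fun a => a ≠ σ i) fun _ => by simp) τ).trans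
      (graftEquiv h (σ i)).symm)

/-- The arguments of the outer operation of `f ∘ᵢ g` at `x`: in slot `i` the value `g` takes on the
`i`-th block of `x`, in the other slots the remaining entries of `x`, in order. -/
def graftArgs {V : Type*} {m n r : ℕ} (h : r + 1 = m + n) (i : Fin m)
    (g : (Fin n → V) → V) (x : Fin r → V) : Fin m → V := fun a =>
  if ha : a = i then g fun l => x ((graftEquiv h i).symm (Sum.inr l))
  else x ((graftEquiv h i).symm (Sum.inl ⟨a, ha⟩))

/-! ### Operads -/

/-- A symmetric operad in `K`-vector spaces, in the partial-composition form: a right action of the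
symmetric groups, compositions `∘ᵢ` and a unit, subject to associativity (sequential and parallel),
equivariance and unitality. -/
structure SymOperad (K : Type u) [Field K] where
  obj : ℕ → Type v
  [addCommGroup : ∀ n, AddCommGroup (obj n)]
  [module : ∀ n, Module K (obj n)]
  /-- the unit -/
  one : obj 1
  /-- `act σ a` is `a σ` -/
  act : ∀ {n : ℕ}, Equiv.Perm (Fin n) → obj n →ₗ[K] obj n
  /-- `comp h i a b` is `a ∘ᵢ b` -/
  comp : ∀ {m n r : ℕ}, r + 1 = m + n → Fin m → obj m →ₗ[K] obj n →ₗ[K] obj r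
  act_one : ∀ {n : ℕ} (a : obj n), act 1 a = a
  act_mul : ∀ {n : ℕ} (σ τ : Equiv.Perm (Fin n)) (a : obj n), act (σ * τ) a = act τ (act σ a)
  comp_act : ∀ {m n r : ℕ} (h : r + 1 = m + n) (i : Fin m) (σ : Equiv.Perm (Fin m))
    (τ : Equiv.Perm (Fin n)) (a : obj m) (b : obj n),
    comp h i (act σ a) (act τ b) = act (graftPerm h i σ τ) (comp h (σ i) a b)
  comp_one : ∀ {m : ℕ} (h : m + 1 = m + 1) (i : Fin m) (a : obj m), comp h i a one = a
  one_comp : ∀ {n : ℕ} (h : n + 1 = 1 + n) (i : Fin 1) (a : obj n), comp h i one a = a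
  /-- `(a ∘ᵢ b) ∘ᵢ₊ⱼ c = a ∘ᵢ (b ∘ⱼ c)` -/
  comp_assoc : ∀ {m n l r s t : ℕ} (h₁ : r + 1 = m + n) (h₂ : t + 1 = r + l)
    (h₃ : s + 1 = n + l) (h₄ : t + 1 = m + s) (i : Fin m) (j : Fin n)
    (a : obj m) (b : obj n) (c : obj l),
    comp h₂ (⟨i + j, by omega⟩ : Fin r) (comp h₁ i a b) c = comp h₄ i a (comp h₃ j b c)
  /-- `(a ∘ᵢ b) ∘ₖ₊ₙ₋₁ c = (a ∘ₖ c) ∘ᵢ b` for slots `i < k` of `a` -/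
  comp_comm : ∀ {m n l r s t : ℕ} (h₁ : r + 1 = m + n) (h₂ : t + 1 = r + l)
    (h₃ : s + 1 = m + l) (h₄ : t + 1 = s + n) (i k : Fin m) (hik : (i : ℕ) < k)
    (a : obj m) (b : obj n) (c : obj l),
    comp h₂ (⟨k + n - 1, by omega⟩ : Fin r) (comp h₁ i a b) c =
      comp h₄ (⟨i, by omega⟩ : Fin s) (comp h₃ k a c) b

attribute [instance] SymOperad.addCommGroup SymOperad.module

/-! ### The free operad on a module of binary generators -/

section FreeOperad

variable {K : Type u} [Field K] {E : Type v} [AddCommGroup E] [Module K E]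

variable (K E) in
/-- Formal operadic expressions in binary generators from `E`, by arity. -/
inductive FreeOperadTerm : ℕ → Type (max u v)
  | gen : E → FreeOperadTerm 2
  | one : FreeOperadTerm 1
  | act {n : ℕ} : Equiv.Perm (Fin n) → FreeOperadTerm n → FreeOperadTerm n
  | comp {m n r : ℕ} : r + 1 = m + n → Fin m → FreeOperadTerm m → FreeOperadTerm n →
      FreeOperadTerm r
  | zero {n : ℕ} : FreeOperadTerm n
  | add {n : ℕ} : FreeOperadTerm n → FreeOperadTerm n → FreeOperadTerm n
  | smul {n : ℕ} : K → FreeOperadTerm n → FreeOperadTerm n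

open FreeOperadTerm in
/-- The congruence on formal expressions generated by the vector space axioms, (bi)linearity of the
action and of the compositions, the operad axioms, and the requirement that `gen` be linear and
equivariant for the symmetric group on two letters. The left action `ρ` on `E` is read as the right
action `e σ = ρ σ⁻¹ e`. -/
inductive FreeOperadRel (ρ : Representation K (Equiv.Perm (Fin 2)) E) :
    ∀ {n : ℕ}, FreeOperadTerm K E n → FreeOperadTerm K E n → Prop
  -- equivalence relation
  | refl {n : ℕ} (a : FreeOperadTerm K E n) : FreeOperadRel ρ a a
  | symm {n : ℕ} {a b : FreeOperadTerm K E n} : FreeOperadRel ρ a b → FreeOperadRel ρ b a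
  | trans {n : ℕ} {a b c : FreeOperadTerm K E n} :
      FreeOperadRel ρ a b → FreeOperadRel ρ b c → FreeOperadRel ρ a c
  -- compatibility with the formal operations
  | act_congr {n : ℕ} (σ : Equiv.Perm (Fin n)) {a b : FreeOperadTerm K E n} :
      FreeOperadRel ρ a b → FreeOperadRel ρ (act σ a) (act σ b)
  | comp_congr {m n r : ℕ} (h : r + 1 = m + n) (i : Fin m) {a a' : FreeOperadTerm K E m}
      {b b' : FreeOperadTerm K E n} : FreeOperadRel ρ a a' → FreeOperadRel ρ b b' →
      FreeOperadRel ρ (comp h i a b) (comp h i a' b')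
  | add_congr {n : ℕ} {a a' b b' : FreeOperadTerm K E n} : FreeOperadRel ρ a a' →
      FreeOperadRel ρ b b' → FreeOperadRel ρ (add a b) (add a' b')
  | smul_congr {n : ℕ} (c : K) {a b : FreeOperadTerm K E n} :
      FreeOperadRel ρ a b → FreeOperadRel ρ (smul c a) (smul c b)
  -- vector space axioms
  | add_assoc {n : ℕ} (a b c : FreeOperadTerm K E n) :
      FreeOperadRel ρ (add (add a b) c) (add a (add b c))
  | add_comm {n : ℕ} (a b : FreeOperadTerm K E n) : FreeOperadRel ρ (add a b) (add b a)
  | zero_add {n : ℕ} (a : FreeOperadTerm K E n) : FreeOperadRel ρ (add zero a) a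
  | zero_smul {n : ℕ} (a : FreeOperadTerm K E n) : FreeOperadRel ρ (smul 0 a) zero
  | one_smul {n : ℕ} (a : FreeOperadTerm K E n) : FreeOperadRel ρ (smul 1 a) a
  | mul_smul {n : ℕ} (c d : K) (a : FreeOperadTerm K E n) :
      FreeOperadRel ρ (smul (c * d) a) (smul c (smul d a))
  | add_smul {n : ℕ} (c d : K) (a : FreeOperadTerm K E n) :
      FreeOperadRel ρ (smul (c + d) a) (add (smul c a) (smul d a))
  | smul_add {n : ℕ} (c : K) (a b : FreeOperadTerm K E n) :
      FreeOperadRel ρ (smul c (add a b)) (add (smul c a) (smul c b))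
  -- linearity of the action and bilinearity of the compositions
  | act_add {n : ℕ} (σ : Equiv.Perm (Fin n)) (a b : FreeOperadTerm K E n) :
      FreeOperadRel ρ (act σ (add a b)) (add (act σ a) (act σ b))
  | act_smul {n : ℕ} (σ : Equiv.Perm (Fin n)) (c : K) (a : FreeOperadTerm K E n) :
      FreeOperadRel ρ (act σ (smul c a)) (smul c (act σ a))
  | add_comp {m n r : ℕ} (h : r + 1 = m + n) (i : Fin m) (a a' : FreeOperadTerm K E m)
      (b : FreeOperadTerm K E n) :
      FreeOperadRel ρ (comp h i (add a a') b) (add (comp h i a b) (comp h i a' b))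
  | smul_comp {m n r : ℕ} (h : r + 1 = m + n) (i : Fin m) (c : K) (a : FreeOperadTerm K E m)
      (b : FreeOperadTerm K E n) :
      FreeOperadRel ρ (comp h i (smul c a) b) (smul c (comp h i a b))
  | comp_add {m n r : ℕ} (h : r + 1 = m + n) (i : Fin m) (a : FreeOperadTerm K E m)
      (b b' : FreeOperadTerm K E n) :
      FreeOperadRel ρ (comp h i a (add b b')) (add (comp h i a b) (comp h i a b'))
  | comp_smul {m n r : ℕ} (h : r + 1 = m + n) (i : Fin m) (c : K) (a : FreeOperadTerm K E m)
      (b : FreeOperadTerm K E n) :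
      FreeOperadRel ρ (comp h i a (smul c b)) (smul c (comp h i a b))
  -- operad axioms
  | act_one {n : ℕ} (a : FreeOperadTerm K E n) : FreeOperadRel ρ (act 1 a) a
  | act_mul {n : ℕ} (σ τ : Equiv.Perm (Fin n)) (a : FreeOperadTerm K E n) :
      FreeOperadRel ρ (act (σ * τ) a) (act τ (act σ a))
  | comp_act {m n r : ℕ} (h : r + 1 = m + n) (i : Fin m) (σ : Equiv.Perm (Fin m))
      (τ : Equiv.Perm (Fin n)) (a : FreeOperadTerm K E m) (b : FreeOperadTerm K E n) :
      FreeOperadRel ρ (comp h i (act σ a) (act τ b)) (act (graftPerm h i σ τ) (comp h (σ i) a b))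
  | comp_one {m : ℕ} (h : m + 1 = m + 1) (i : Fin m) (a : FreeOperadTerm K E m) :
      FreeOperadRel ρ (comp h i a one) a
  | one_comp {n : ℕ} (h : n + 1 = 1 + n) (i : Fin 1) (a : FreeOperadTerm K E n) :
      FreeOperadRel ρ (comp h i one a) a
  | comp_assoc {m n l r s t : ℕ} (h₁ : r + 1 = m + n) (h₂ : t + 1 = r + l)
      (h₃ : s + 1 = n + l) (h₄ : t + 1 = m + s) (i : Fin m) (j : Fin n)
      (a : FreeOperadTerm K E m) (b : FreeOperadTerm K E n) (c : FreeOperadTerm K E l) :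
      FreeOperadRel ρ (comp h₂ (⟨i + j, by omega⟩ : Fin r) (comp h₁ i a b) c)
        (comp h₄ i a (comp h₃ j b c))
  | comp_comm {m n l r s t : ℕ} (h₁ : r + 1 = m + n) (h₂ : t + 1 = r + l)
      (h₃ : s + 1 = m + l) (h₄ : t + 1 = s + n) (i k : Fin m) (hik : (i : ℕ) < k)
      (a : FreeOperadTerm K E m) (b : FreeOperadTerm K E n) (c : FreeOperadTerm K E l) :
      FreeOperadRel ρ (comp h₂ (⟨k + n - 1, by omega⟩ : Fin r) (comp h₁ i a b) c)
        (comp h₄ (⟨i, by omega⟩ : Fin s) (comp h₃ k a c) b)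
  -- the generators form an equivariant copy of `E`
  | gen_add (e f : E) : FreeOperadRel ρ (gen (e + f)) (add (gen e) (gen f))
  | gen_smul (c : K) (e : E) : FreeOperadRel ρ (gen (c • e)) (smul c (gen e))
  | gen_act (σ : Equiv.Perm (Fin 2)) (e : E) :
      FreeOperadRel ρ (act σ (gen e)) (gen (ρ σ⁻¹ e))

variable (ρ : Representation K (Equiv.Perm (Fin 2)) E)

def freeOperadSetoid (n : ℕ) : Setoid (FreeOperadTerm K E n) where
  r := FreeOperadRel ρ
  iseqv := ⟨FreeOperadRel.refl, FreeOperadRel.symm, FreeOperadRel.trans⟩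

/-- The underlying space in arity `n` of the free operad on `E`. -/
def FreeOperadObj (n : ℕ) : Type (max u v) := Quotient (freeOperadSetoid ρ n)

namespace FreeOperadObj

variable {ρ} {n : ℕ}

def mk (a : FreeOperadTerm K E n) : FreeOperadObj ρ n := Quotient.mk (freeOperadSetoid ρ n) a

theorem sound {a b : FreeOperadTerm K E n} (h : FreeOperadRel ρ a b) :
    (mk a : FreeOperadObj ρ n) = mk b := Quotient.sound h

instance : Add (FreeOperadObj ρ n) :=
  ⟨Quotient.map₂ .add fun _ _ h _ _ h' => .add_congr h h'⟩

instance : SMul K (FreeOperadObj ρ n) :=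
  ⟨fun c => Quotient.map (.smul c) fun _ _ h => .smul_congr c h⟩

instance : Zero (FreeOperadObj ρ n) := ⟨mk .zero⟩

instance : AddCommMonoid (FreeOperadObj ρ n) where
  add_assoc := by rintro ⟨a⟩ ⟨b⟩ ⟨c⟩; exact sound (.add_assoc a b c)
  zero_add := by rintro ⟨a⟩; exact sound (.zero_add a)
  add_zero := by rintro ⟨a⟩; exact sound (.trans (.add_comm _ _) (.zero_add a))
  add_comm := by rintro ⟨a⟩ ⟨b⟩; exact sound (.add_comm a b)
  nsmul := nsmulRec

theorem smul_zero' (c : K) : FreeOperadRel ρ (.smul c .zero : FreeOperadTerm K E n) .zero :=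
  .trans (.smul_congr c (.symm (.zero_smul .zero)))
    (.trans (.symm (.mul_smul c 0 .zero)) (by rw [mul_zero]; exact .zero_smul _))

instance : Module K (FreeOperadObj ρ n) where
  one_smul := by rintro ⟨a⟩; exact sound (.one_smul a)
  mul_smul := by rintro c d ⟨a⟩; exact sound (.mul_smul c d a)
  smul_zero c := sound (smul_zero' c)
  smul_add := by rintro c ⟨a⟩ ⟨b⟩; exact sound (.smul_add c a b)
  add_smul := by rintro c d ⟨a⟩; exact sound (.add_smul c d a)
  zero_smul := by rintro ⟨a⟩; exact sound (.zero_smul a)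

instance : AddCommGroup (FreeOperadObj ρ n) := Module.addCommMonoidToAddCommGroup K

end FreeOperadObj

open FreeOperadObj in
/-- The free operad `F(E)` on `E`, placed in arity `2`. -/
def freeOperad : SymOperad.{u, max u v} K where
  obj := FreeOperadObj ρ
  one := mk .one
  act σ :=
    { toFun := Quotient.map (.act σ) fun _ _ h => .act_congr σ h
      map_add' := by rintro ⟨a⟩ ⟨b⟩; exact sound (.act_add σ a b)
      map_smul' := by rintro c ⟨a⟩; exact sound (.act_smul σ c a) }
  comp h i := LinearMap.mk₂ K
    (Quotient.map₂ (.comp h i) fun _ _ h₁ _ _ h₂ => .comp_congr h i h₁ h₂)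
    (by rintro ⟨a⟩ ⟨a'⟩ ⟨b⟩; exact sound (.add_comp h i a a' b))
    (by rintro c ⟨a⟩ ⟨b⟩; exact sound (.smul_comp h i c a b))
    (by rintro ⟨a⟩ ⟨b⟩ ⟨b'⟩; exact sound (.comp_add h i a b b'))
    (by rintro c ⟨a⟩ ⟨b⟩; exact sound (.comp_smul h i c a b))
  act_one := by rintro n ⟨a⟩; exact sound (.act_one a)
  act_mul := by rintro n σ τ ⟨a⟩; exact sound (.act_mul σ τ a)
  comp_act := by rintro m n r h i σ τ ⟨a⟩ ⟨b⟩; exact sound (.comp_act h i σ τ a b)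
  comp_one := by rintro m h i ⟨a⟩; exact sound (.comp_one h i a)
  one_comp := by rintro n h i ⟨a⟩; exact sound (.one_comp h i a)
  comp_assoc := by
    rintro m n l r s t h₁ h₂ h₃ h₄ i j ⟨a⟩ ⟨b⟩ ⟨c⟩
    exact sound (.comp_assoc h₁ h₂ h₃ h₄ i j a b c)
  comp_comm := by
    rintro m n l r s t h₁ h₂ h₃ h₄ i k hik ⟨a⟩ ⟨b⟩ ⟨c⟩
    exact sound (.comp_comm h₁ h₂ h₃ h₄ i k hik a b c)

/-- The inclusion of the generators `E → F(E)(2)`. -/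
def freeOperadGen : E →ₗ[K] (freeOperad ρ).obj 2 where
  toFun e := FreeOperadObj.mk (.gen e)
  map_add' e f := FreeOperadObj.sound (.gen_add e f)
  map_smul' c e := FreeOperadObj.sound (.gen_smul c e)

end FreeOperad

/-! ### Operadic ideals, quotients, binary quadratic operads -/

namespace SymOperad

variable {K : Type u} [Field K]

/-- Operadic ideals: subspaces stable under the symmetric groups and under composition, on either
side, with arbitrary elements of the operad. -/
structure OperadIdeal (P : SymOperad.{u, v} K) where
  carrier : ∀ n : ℕ, Submodule K (P.obj n)
  act_mem : ∀ {n : ℕ} (σ : Equiv.Perm (Fin n)) {a : P.obj n}, a ∈ carrier n →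
    P.act σ a ∈ carrier n
  comp_mem_left : ∀ {m n r : ℕ} (h : r + 1 = m + n) (i : Fin m) {a : P.obj m} (b : P.obj n),
    a ∈ carrier m → P.comp h i a b ∈ carrier r
  comp_mem_right : ∀ {m n r : ℕ} (h : r + 1 = m + n) (i : Fin m) (a : P.obj m) {b : P.obj n},
    b ∈ carrier n → P.comp h i a b ∈ carrier r

/-- The smallest operadic ideal containing a given subspace in arity `k`. -/
def idealSpan (P : SymOperad.{u, v} K) {k : ℕ} (R : Submodule K (P.obj k)) : P.OperadIdeal where
  carrier n := ⨅ (I : P.OperadIdeal) (_ : R ≤ I.carrier k), I.carrier n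
  act_mem σ a ha := by
    simp only [Submodule.mem_iInf] at ha ⊢
    exact fun I hI => I.act_mem σ (ha I hI)
  comp_mem_left h i a b ha := by
    simp only [Submodule.mem_iInf] at ha ⊢
    exact fun I hI => I.comp_mem_left h i b (ha I hI)
  comp_mem_right h i a b hb := by
    simp only [Submodule.mem_iInf] at hb ⊢
    exact fun I hI => I.comp_mem_right h i a (hb I hI)

/-- The composition induced on the quotient by an operadic ideal. -/
def OperadIdeal.quotComp {P : SymOperad.{u, v} K} (I : P.OperadIdeal) {m n r : ℕ}
    (h : r + 1 = m + n) (i : Fin m) :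
    (P.obj m ⧸ I.carrier m) →ₗ[K] (P.obj n ⧸ I.carrier n) →ₗ[K] (P.obj r ⧸ I.carrier r) :=
  (I.carrier m).liftQ
    (LinearMap.mk₂ K
      (fun a => (I.carrier n).mapQ (I.carrier r) (P.comp h i a)
        fun _ hb => I.comp_mem_right h i a hb)
      (fun a a' b => by
        obtain ⟨b, rfl⟩ := Submodule.mkQ_surjective _ b
        simp)
      (fun c a b => by
        obtain ⟨b, rfl⟩ := Submodule.mkQ_surjective _ b
        simp)
      (fun a b b' => by simp)
      (fun c a b => by simp))
    (fun a ha => by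
      ext b
      simpa using I.comp_mem_left h i b ha)

theorem OperadIdeal.quotComp_mkQ {P : SymOperad.{u, v} K} (I : P.OperadIdeal) {m n r : ℕ}
    (h : r + 1 = m + n) (i : Fin m) (a : P.obj m) (b : P.obj n) :
    I.quotComp h i ((I.carrier m).mkQ a) ((I.carrier n).mkQ b) =
      (I.carrier r).mkQ (P.comp h i a b) := rfl

/-- The quotient of an operad by an operadic ideal. -/
def quotient (P : SymOperad.{u, v} K) (I : P.OperadIdeal) : SymOperad.{u, v} K where
  obj n := P.obj n ⧸ I.carrier n
  one := (I.carrier 1).mkQ P.one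
  act {n} σ := (I.carrier n).mapQ (I.carrier n) (P.act σ) fun _ ha => I.act_mem σ ha
  comp h i := I.quotComp h i
  act_one a := by
    obtain ⟨a, rfl⟩ := Submodule.mkQ_surjective _ a
    simp [P.act_one]
  act_mul σ τ a := by
    obtain ⟨a, rfl⟩ := Submodule.mkQ_surjective _ a
    simp [P.act_mul]
  comp_act h i σ τ a b := by
    obtain ⟨a, rfl⟩ := Submodule.mkQ_surjective _ a
    obtain ⟨b, rfl⟩ := Submodule.mkQ_surjective _ b
    exact congrArg (Submodule.mkQ _) (P.comp_act h i σ τ a b)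
  comp_one h i a := by
    obtain ⟨a, rfl⟩ := Submodule.mkQ_surjective _ a
    exact congrArg (Submodule.mkQ _) (P.comp_one h i a)
  one_comp h i a := by
    obtain ⟨a, rfl⟩ := Submodule.mkQ_surjective _ a
    exact congrArg (Submodule.mkQ _) (P.one_comp h i a)
  comp_assoc h₁ h₂ h₃ h₄ i j a b c := by
    obtain ⟨a, rfl⟩ := Submodule.mkQ_surjective _ a
    obtain ⟨b, rfl⟩ := Submodule.mkQ_surjective _ b
    obtain ⟨c, rfl⟩ := Submodule.mkQ_surjective _ c
    simp only [OperadIdeal.quotComp_mkQ]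
    rw [P.comp_assoc h₁ h₂ h₃ h₄]
  comp_comm h₁ h₂ h₃ h₄ i k hik a b c := by
    obtain ⟨a, rfl⟩ := Submodule.mkQ_surjective _ a
    obtain ⟨b, rfl⟩ := Submodule.mkQ_surjective _ b
    obtain ⟨c, rfl⟩ := Submodule.mkQ_surjective _ c
    simp only [OperadIdeal.quotComp_mkQ]
    rw [P.comp_comm h₁ h₂ h₃ h₄ i k hik]

/-- `R ⊆ F(E)(3)` is stable under the symmetric group, i.e. it is a quadratic relation. -/
def IsQuadraticRelation {E : Type v} [AddCommGroup E] [Module K E]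
    (ρ : Representation K (Equiv.Perm (Fin 2)) E) (R : Submodule K ((freeOperad ρ).obj 3)) : Prop :=
  ∀ (σ : Equiv.Perm (Fin 3)), ∀ r ∈ R, (freeOperad ρ).act σ r ∈ R

/-- The binary quadratic operad `P(E, R) = F(E) / (R)`. -/
def binaryQuadratic {E : Type v} [AddCommGroup E] [Module K E]
    (ρ : Representation K (Equiv.Perm (Fin 2)) E) (R : Submodule K ((freeOperad ρ).obj 3)) :
    SymOperad.{u, max u v} K :=
  (freeOperad ρ).quotient ((freeOperad ρ).idealSpan R)

/-- The map `E → P(E, R)(2)`. -/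
def binaryQuadraticGen {E : Type v} [AddCommGroup E] [Module K E]
    (ρ : Representation K (Equiv.Perm (Fin 2)) E) (R : Submodule K ((freeOperad ρ).obj 3)) :
    E →ₗ[K] (binaryQuadratic ρ R).obj 2 :=
  (((freeOperad ρ).idealSpan R).carrier 2).mkQ ∘ₗ freeOperadGen ρ

end SymOperad

/-! ### Graded vector spaces and (dg) algebras over operads

A graded vector space is a vector space `V` with subspaces `𝒱 k` (`k : ℤ`) of which it is the
internal direct sum. -/

/-- The Koszul sign of `x₀ ⊗ ⋯ ⊗ xₙ₋₁ ↦ x_{σ⁻¹ 0} ⊗ ⋯ ⊗ x_{σ⁻¹ (n-1)}`, for `xᵢ` of degree `k i`: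
one factor `(-1) ^ (k i * k j)` for every pair `i < j` whose order is reversed. -/
def koszulSign {n : ℕ} (σ : Equiv.Perm (Fin n)) (k : Fin n → ℤ) : ℤˣ :=
  ∏ i : Fin n, ∏ j : Fin n, if i < j ∧ σ j < σ i then (k i * k j).negOnePow else 1

namespace SymOperad

variable {K : Type u} [Field K]

/-- A graded algebra over `P` on the graded vector space `(V, 𝒱)`: a morphism from `P` to the
endomorphism operad of `V`, written out. Here `P(n)` is placed in degree `p * (n - 1)`, so that
binary operations have degree `p`; for `p = 0` all operations preserve degrees. It is meant for even
`p` only, when operations cause no Koszul sign. The symmetric groups act on operations by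
`(f σ)(x₁, …, xₙ) = ± f (x_{σ⁻¹ 1}, …, x_{σ⁻¹ n})` with the Koszul sign. -/
structure GradedAlgebra (P : SymOperad.{u, v} K) (p : ℤ) {V : Type w} [AddCommGroup V] [Module K V]
    (𝒱 : ℤ → Submodule K V) where
  /-- `V` is the direct sum of the `𝒱 k` -/
  isInternal : DirectSum.IsInternal 𝒱
  op : ∀ {n : ℕ}, P.obj n →ₗ[K] MultilinearMap K (fun _ : Fin n => V) V
  op_mem : ∀ {n : ℕ} (a : P.obj n) (k : Fin n → ℤ) (x : Fin n → V), (∀ i, x i ∈ 𝒱 (k i)) →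
    op a x ∈ 𝒱 ((∑ i, k i) + p * ((n : ℤ) - 1))
  op_one : ∀ x : Fin 1 → V, op P.one x = x 0
  op_comp : ∀ {m n r : ℕ} (h : r + 1 = m + n) (i : Fin m) (a : P.obj m) (b : P.obj n)
    (x : Fin r → V), op (P.comp h i a b) x = op a (graftArgs h i (op b) x)
  op_act : ∀ {n : ℕ} (σ : Equiv.Perm (Fin n)) (a : P.obj n) (k : Fin n → ℤ) (x : Fin n → V),
    (∀ i, x i ∈ 𝒱 (k i)) → op (P.act σ a) x = koszulSign σ k • op a (fun i => x (σ⁻¹ i))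

/-- A dg algebra over `P`, with operations as above and a differential `d` of degree `q` (`q` odd)
that squares to zero and is a derivation of every operation. -/
structure DGAlgebra (P : SymOperad.{u, v} K) (p q : ℤ) {V : Type w} [AddCommGroup V] [Module K V]
    (𝒱 : ℤ → Submodule K V) extends GradedAlgebra P p 𝒱 where
  d : V →ₗ[K] V
  d_mem : ∀ (k : ℤ), ∀ x ∈ 𝒱 k, d x ∈ 𝒱 (k + q)
  d_d : ∀ x, d (d x) = 0
  d_op : ∀ {n : ℕ} (a : P.obj n) (k : Fin n → ℤ) (x : Fin n → V), (∀ i, x i ∈ 𝒱 (k i)) →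
    d (op a x) =
      ∑ i, (∑ j with j < i, k j).negOnePow • op a (Function.update x i (d (x i)))

end SymOperad

section Graded

variable {K : Type u} [Field K] {V : Type w} [AddCommGroup V] [Module K V]

/-- The linear map `x ↦ (-1) ^ |x| x`. -/
noncomputable def gradeInvolution {𝒱 : ℤ → Submodule K V} (h : DirectSum.IsInternal 𝒱) :
    V →ₗ[K] V :=
  DirectSum.toModule K ℤ V (fun k => k.negOnePow • (𝒱 k).subtype) ∘ₗ
    (LinearEquiv.ofBijective (DirectSum.coeLinearMap 𝒱) h).symm.toLinearMap

theorem gradeInvolution_apply {𝒱 : ℤ → Submodule K V} (h : DirectSum.IsInternal 𝒱) {k : ℤ} {x : V}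
    (hx : x ∈ 𝒱 k) : gradeInvolution h x = k.negOnePow • x := by
  have : (LinearEquiv.ofBijective (DirectSum.coeLinearMap 𝒱) h).symm x =
      DirectSum.lof K ℤ (fun k => 𝒱 k) k ⟨x, hx⟩ := by
    rw [LinearEquiv.symm_apply_eq]
    exact (DirectSum.coeLinearMap_lof 𝒱 k ⟨x, hx⟩).symm
  rw [gradeInvolution, LinearMap.comp_apply, LinearEquiv.coe_coe, this, DirectSum.toModule_lof]
  rfl

/-- A subspace is graded if it is spanned by its homogeneous elements. -/
def IsGradedSubspace (𝒱 : ℤ → Submodule K V) (W : Submodule K V) : Prop :=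
  W = ⨆ k, W ⊓ 𝒱 k

/-- The induced grading of a subspace. -/
def subGrading (𝒱 : ℤ → Submodule K V) (W : Submodule K V) (k : ℤ) : Submodule K W :=
  (𝒱 k).comap W.subtype

/-- The suspension `sV`: a copy of `V`, with degrees raised by one. -/
def Suspension (V : Type w) : Type w := V

instance : AddCommGroup (Suspension V) := inferInstanceAs (AddCommGroup V)

instance : Module K (Suspension V) := inferInstanceAs (Module K V)

variable (K V) in
/-- The degree shifting operator `s : V → sV`. -/
def susp : V ≃ₗ[K] Suspension V := LinearEquiv.refl K V

/-- The subspace `sW ⊆ sV` for `W ⊆ V`. -/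
def suspSubspace (W : Submodule K V) : Submodule K (Suspension V) :=
  W.map (susp K V).toLinearMap

/-- `(sV)ₖ = s (Vₖ₋₁)`. -/
def suspGrading (𝒱 : ℤ → Submodule K V) (k : ℤ) : Submodule K (Suspension V) :=
  suspSubspace (𝒱 (k - 1))

end Graded

/-! ### Derived brackets -/

namespace SymOperad.DGAlgebra

variable {K : Type u} [Field K] {P : SymOperad.{u, v} K} {p q : ℤ} {V : Type w} [AddCommGroup V]
  [Module K V] {𝒱 : ℤ → Submodule K V}

/-- The derived bracket `[sx, sy]_d = -(-1) ^ |x| s [dx, y]` of the multiplication `μ`. -/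
noncomputable def derivedLeft (A : DGAlgebra P p q 𝒱) (μ : P.obj 2) (a b : Suspension V) :
    Suspension V :=
  -susp K V (A.op μ ![A.d (gradeInvolution A.isInternal ((susp K V).symm a)), (susp K V).symm b])

/-- The derived bracket `[sx, sy]^d = s [x, dy]` of the multiplication `μ`. -/
noncomputable def derivedRight (A : DGAlgebra P p q 𝒱) (μ : P.obj 2) (a b : Suspension V) :
    Suspension V :=
  susp K V (A.op μ ![(susp K V).symm a, A.d ((susp K V).symm b)])

end SymOperad.DGAlgebra

/-!
The operation `f ∈ P(n)` acts on `sA'` by `(sx₀, …, sxₘ) ↦ s f(x₀, dx₁, …, dxₘ)`, with `m + 1 = n`: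
every argument but the first is differentiated, and no sign is needed. For a generator this is the
bracket `s[x, dy]`; it agrees with `-(-1)^|x| s[dx, y]` because `d[x, y] = 0` on `A'`. The relations
of `P` hold automatically, since `f` already acts on `A`; what has to be checked is that `sA'` is
stable and that the new operations are compatible with composition and with permutations.

The key is a count of undifferentiated arguments (`SymOperad.DGAlgebra.op_mem_weightSubspace`). Give
the subspaces `dA'`, `A'`, `0`, `0`, … the weights `0`, `1`, `2`, `3`, …. The assumptions on `A'` say
that the generators add weights, and this passes to compositions, hence to all of `P`. Weight one
shows that `f(x₀, dx₁, …, dxₘ)` lies in `A'`, weight two that `f` vanishes as soon as two arguments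
are undifferentiated.

* Composition `a ∘ᵢ b`: if `i` is the first slot, the formula composes directly; otherwise `b` is
  applied to differentiated arguments only, and `b(dy₀, …, dyₗ) = d b(y₀, dy₁, …, dyₗ)`, which is what
  the formula for `a` asks for (`d_op_diffTail`, `graftArgs_diffTail`).
* Permutations: the undifferentiated argument has to be moved back to the first slot. Applying `d` to
  the vanishing value with two undifferentiated arguments shows that this costs the sign of moving an
  odd operator past the preceding `dxᵢ` (`op_undiff_eq`). This sign is the quotient of the Koszul
  signs in the degrees of the arguments `x₀, dx₁, …, dxₘ` and of `sx₀, …, sxₘ`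
  (`koszulSign_of_parity`).
-/

/-! ### Multilinear maps and gradings -/

/-- A multilinear map that sends tuples of homogeneous vectors from graded subspaces `S i` into a
subspace `T` sends all tuples of vectors from the `S i` into `T`. -/
theorem MultilinearMap.mem_of_homogeneous {K V V' : Type*} [Field K] [AddCommGroup V] [Module K V]
    [AddCommGroup V'] [Module K V'] {𝒱 : ℤ → Submodule K V} {n : ℕ}
    (M : MultilinearMap K (fun _ : Fin n => V) V') (S : Fin n → Submodule K V) (T : Submodule K V')
    (hS : ∀ i, S i ≤ ⨆ k, S i ⊓ 𝒱 k)
    (hM : ∀ (k : Fin n → ℤ) (y : Fin n → V), (∀ i, y i ∈ S i) → (∀ i, y i ∈ 𝒱 (k i)) → M y ∈ T)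
    (y : Fin n → V) (hy : ∀ i, y i ∈ S i) : M y ∈ T := by
  -- one coordinate at a time, `s` being the set of coordinates not assumed homogeneous
  have key : ∀ s : Finset (Fin n), ∀ y : Fin n → V, (∀ i, y i ∈ S i) →
      (∀ i ∉ s, ∃ k, y i ∈ 𝒱 k) → M y ∈ T := by
    intro s
    induction s using Finset.induction_on with
    | empty =>
      intro y hy hk
      choose k hk using fun i => hk i (Finset.notMem_empty i)
      exact hM k y hy hk
    | insert a s _ ih =>
      intro y hy hk
      rw [← Function.update_eq_self a y]
      refine Submodule.iSup_induction _ (motive := fun z => M (Function.update y a z) ∈ T)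
        (hS a (hy a)) ?_ ?_ ?_
      · intro l z hz
        refine ih _ (fun i => ?_) (fun i hi => ?_)
        · rcases eq_or_ne i a with rfl | hia
          · simpa using hz.1
          · simpa [hia] using hy i
        · rcases eq_or_ne i a with rfl | hia
          · exact ⟨l, by simpa using hz.2⟩
          · simpa [hia] using hk i (by simp [hia, hi])
      · simp
      · intro z z' hz hz'
        rw [M.map_update_add]
        exact T.add_mem hz hz'
  exact key Finset.univ y hy (by simp)

/-- Two multilinear maps on a graded space that agree on homogeneous vectors are equal. -/
theorem MultilinearMap.ext_of_homogeneous {K V V' : Type*} [Field K] [AddCommGroup V] [Module K V]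
    [AddCommGroup V'] [Module K V'] {𝒱 : ℤ → Submodule K V} (h𝒱 : ⨆ k, 𝒱 k = ⊤) {n : ℕ}
    {M N : MultilinearMap K (fun _ : Fin n => V) V'}
    (h : ∀ (k : Fin n → ℤ) (y : Fin n → V), (∀ i, y i ∈ 𝒱 (k i)) → M y = N y) : M = N := by
  ext y
  have := (M - N).mem_of_homogeneous (𝒱 := 𝒱) (fun _ => ⊤) ⊥ (by simp [h𝒱])
    (fun k y _ hy => by simp [h k y hy]) y (by simp)
  simpa [sub_eq_zero] using this

theorem DirectSum.IsInternal.subGrading {K V : Type*} [Field K] [AddCommGroup V] [Module K V]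
    {𝒱 : ℤ → Submodule K V} (h : DirectSum.IsInternal 𝒱) {W : Submodule K V}
    (hW : IsGradedSubspace 𝒱 W) : DirectSum.IsInternal (subGrading 𝒱 W) := by
  rw [DirectSum.isInternal_submodule_iff_iSupIndep_and_iSup_eq_top] at h ⊢
  have hmap : ∀ k, (_root_.subGrading 𝒱 W k).map W.subtype = W ⊓ 𝒱 k := fun k => by
    rw [_root_.subGrading, Submodule.map_comap_subtype]
  constructor
  · intro k
    refine Submodule.disjoint_def.2 fun x hx hx' => Subtype.ext ?_
    refine Submodule.disjoint_def.1 ((h.1 k).mono ?_ ?_) x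
      (Submodule.mem_map_of_mem (f := W.subtype) hx) (Submodule.mem_map_of_mem (f := W.subtype) hx')
    · rw [hmap]; exact inf_le_right
    · simp only [Submodule.map_iSup, hmap]
      exact iSup₂_mono fun _ _ => inf_le_right
  · apply Submodule.map_injective_of_injective W.injective_subtype
    rw [Submodule.map_iSup, Submodule.map_top, Submodule.range_subtype]
    simp only [hmap]
    exact hW.symm

theorem iSup_suspSubspace {K V : Type*} [Field K] [AddCommGroup V] [Module K V]
    (𝒲 : ℤ → Submodule K V) : ⨆ k, suspSubspace (𝒲 (k - 1)) = suspSubspace (⨆ k, 𝒲 k) := by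
  simp only [suspSubspace]
  rw [← Submodule.map_iSup]
  exact congrArg _ ((Equiv.subRight (1 : ℤ)).iSup_comp (g := 𝒲))

theorem DirectSum.IsInternal.suspGrading {K V : Type*} [Field K] [AddCommGroup V] [Module K V]
    {𝒱 : ℤ → Submodule K V} (h : DirectSum.IsInternal 𝒱) :
    DirectSum.IsInternal (suspGrading 𝒱) := by
  rw [DirectSum.isInternal_submodule_iff_iSupIndep_and_iSup_eq_top] at h ⊢
  constructor
  · exact (iSupIndep_map_orderIso_iff (Submodule.orderIsoMapComap (susp K V))).2
      (h.1.comp (Equiv.subRight (1 : ℤ)).injective)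
  · refine (iSup_suspSubspace 𝒱).trans ?_
    rw [h.2, suspSubspace, Submodule.map_top]
    exact LinearEquiv.range _

theorem IsGradedSubspace.suspSubspace {K V : Type*} [Field K] [AddCommGroup V] [Module K V]
    {𝒱 : ℤ → Submodule K V} {W : Submodule K V} (hW : IsGradedSubspace 𝒱 W) :
    IsGradedSubspace (suspGrading 𝒱) (suspSubspace W) := by
  have hinf : ∀ k, _root_.suspSubspace W ⊓ suspGrading 𝒱 k =
      _root_.suspSubspace (W ⊓ 𝒱 (k - 1)) := fun k =>
    (Submodule.map_inf _ (susp K V).injective).symm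
  unfold IsGradedSubspace at hW ⊢
  simp only [hinf]
  rw [iSup_suspSubspace (fun k => W ⊓ 𝒱 k), ← hW]

theorem DirectSum.IsInternal.gradeInvolution_mem {K V : Type*} [Field K] [AddCommGroup V]
    [Module K V] {𝒱 : ℤ → Submodule K V} (h : DirectSum.IsInternal 𝒱) {W : Submodule K V}
    (hW : IsGradedSubspace 𝒱 W) {x : V} (hx : x ∈ W) : gradeInvolution h x ∈ W := by
  rw [hW] at hx
  refine Submodule.iSup_induction _ (motive := fun z => gradeInvolution h z ∈ W) hx ?_ ?_ ?_
  · intro k z hz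
    rw [gradeInvolution_apply h hz.2, Units.smul_def]
    exact zsmul_mem hz.1 _
  · simp
  · intro z z' hz hz'
    rw [map_add]
    exact W.add_mem hz hz'

theorem gradeInvolution_gradeInvolution {K V : Type*} [Field K] [AddCommGroup V]
    [Module K V] {𝒱 : ℤ → Submodule K V} (h : DirectSum.IsInternal 𝒱) (x : V) :
    gradeInvolution h (gradeInvolution h x) = x := by
  have hx : x ∈ ⨆ k, 𝒱 k := by
    rw [((DirectSum.isInternal_submodule_iff_iSupIndep_and_iSup_eq_top 𝒱).1 h).2]
    trivial
  refine Submodule.iSup_induction _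
    (motive := fun z => gradeInvolution h (gradeInvolution h z) = z) hx ?_ ?_ ?_
  · intro k z hz
    rw [gradeInvolution_apply h hz, Units.smul_def, map_zsmul, gradeInvolution_apply h hz,
      ← Units.smul_def, smul_smul, Int.units_mul_self, one_smul]
  · simp
  · intro z z' hz hz'
    rw [map_add, map_add, hz, hz']

/-! ### Koszul signs -/

/-- Changing the parity of the degree of the first argument changes the Koszul sign by the degrees
of the arguments that are moved past it. -/
theorem koszulSign_of_parity {m : ℕ} (σ : Equiv.Perm (Fin (m + 1))) {a b : Fin (m + 1) → ℤ}
    (h₀ : Odd (a 0 - b 0)) (h : ∀ i ≠ 0, Even (a i - b i)) :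
    koszulSign σ a = koszulSign σ b * (∑ i with σ i < σ 0, b i).negOnePow := by
  have hsum : ∀ s : Finset (Fin (m + 1)),
      (∑ i ∈ s, b i).negOnePow = ∏ i ∈ s, (b i).negOnePow := by
    intro s
    induction s using Finset.induction_on with
    | empty => simp
    | insert i s hi ih => rw [Finset.sum_insert hi, Finset.prod_insert hi, Int.negOnePow_add, ih]
  -- the pairs that contain the first argument
  have hfirst : (∏ j, if 0 < j ∧ σ j < σ 0 then (a 0 * a j).negOnePow else 1) =
      (∏ j, if 0 < j ∧ σ j < σ 0 then (b 0 * b j).negOnePow else 1) *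
        ∏ j, if σ j < σ 0 then (b j).negOnePow else 1 := by
    rw [← Finset.prod_mul_distrib]
    refine Finset.prod_congr rfl fun j _ => ?_
    rcases eq_or_ne j 0 with rfl | hj
    · simp
    · have h₂ := h j hj
      simp only [Fin.pos_of_ne_zero hj, true_and]
      split_ifs
      · rw [← Int.negOnePow_add, Int.negOnePow_eq_iff]
        rw [← Int.not_even_iff_odd] at h₀
        simp only [Int.even_sub, Int.even_add, Int.even_mul] at h₀ h₂ ⊢
        tauto
      · simp
  have hrest : ∀ i : Fin m,
      (∏ j, if i.succ < j ∧ σ j < σ i.succ then (a i.succ * a j).negOnePow else 1) =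
        ∏ j, if i.succ < j ∧ σ j < σ i.succ then (b i.succ * b j).negOnePow else 1 := by
    refine fun i => Finset.prod_congr rfl fun j _ => ?_
    split_ifs with hij
    · have h₁ := h _ (Fin.succ_ne_zero i)
      have h₂ := h j (Fin.pos_iff_ne_zero.1 ((Fin.succ_pos i).trans hij.1))
      rw [Int.negOnePow_eq_iff]
      simp only [Int.even_sub, Int.even_mul] at h₁ h₂ ⊢
      tauto
    · rfl
  rw [koszulSign, koszulSign, Fin.prod_univ_succ, hfirst, Finset.prod_congr rfl fun i _ => hrest i,
    Fin.prod_univ_succ (fun i => ∏ j, if i < j ∧ σ j < σ i then (b i * b j).negOnePow else 1),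
    hsum, Finset.prod_filter]
  exact mul_right_comm _ _ _

/-! ### Binary quadratic operads -/

namespace SymOperad

variable {K : Type*} [Field K] {E : Type*} [AddCommGroup E] [Module K E]
  {ρ : Representation K (Equiv.Perm (Fin 2)) E} {R : Submodule K ((freeOperad ρ).obj 3)}

/-- A binary quadratic operad is generated by the unit and `E` under the operad operations. -/
theorem binaryQuadratic_induction
    {motive : ∀ n : ℕ, (binaryQuadratic ρ R).obj n → Prop}
    (gen : ∀ e, motive 2 (binaryQuadraticGen ρ R e))
    (one : motive 1 (binaryQuadratic ρ R).one)
    (act : ∀ {n : ℕ} (σ : Equiv.Perm (Fin n)) (a : (binaryQuadratic ρ R).obj n),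
      motive n a → motive n ((binaryQuadratic ρ R).act σ a))
    (comp : ∀ {m n r : ℕ} (h : r + 1 = m + n) (i : Fin m) (a : (binaryQuadratic ρ R).obj m)
      (b : (binaryQuadratic ρ R).obj n), motive m a → motive n b →
      motive r ((binaryQuadratic ρ R).comp h i a b))
    (zero : ∀ n, motive n 0)
    (add : ∀ {n : ℕ} (a b : (binaryQuadratic ρ R).obj n), motive n a → motive n b →
      motive n (a + b))
    (smul : ∀ {n : ℕ} (c : K) (a : (binaryQuadratic ρ R).obj n), motive n a → motive n (c • a))
    {n : ℕ} (a : (binaryQuadratic ρ R).obj n) : motive n a := by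
  suffices h : ∀ t : FreeOperadTerm K E n,
      motive n ((((freeOperad ρ).idealSpan R).carrier n).mkQ (FreeOperadObj.mk t)) by
    obtain ⟨⟨t⟩, rfl⟩ := Submodule.mkQ_surjective _ a
    exact h t
  clear a
  intro t
  induction t with
  | gen e => exact gen e
  | one => exact one
  | act σ t ih => exact act σ _ ih
  | comp h i t u iht ihu => exact comp h i _ _ iht ihu
  | zero => exact zero _
  | add t u iht ihu => exact add _ _ iht ihu
  | smul c t ih => exact smul c _ ih

/-- A grafting has no leaves only if the inner operation has none, so nullary operations are zero. -/
theorem binaryQuadratic_arity_zero (a : (binaryQuadratic ρ R).obj 0) : a = 0 := by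
  suffices h : ∀ {n : ℕ} (a : (binaryQuadratic ρ R).obj n), n = 0 → a = 0 from h a rfl
  intro n a
  induction a using binaryQuadratic_induction with
  | gen e => omega
  | one => omega
  | act σ a ih => intro hn; rw [ih hn, map_zero]
  | comp h i a b iha ihb =>
    intro hn
    rw [ihb (by have := i.pos; omega), map_zero]
  | zero n => intro; rfl
  | add a b iha ihb => intro hn; rw [iha hn, ihb hn, add_zero]
  | smul c a ih => intro hn; rw [ih hn, smul_zero]

end SymOperad

/-! ### Operations applied to differentiated arguments -/

namespace SymOperad.DGAlgebra

variable {K : Type*} [Field K] {P : SymOperad K} {p q : ℤ} {V : Type*} [AddCommGroup V]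
  [Module K V] {𝒱 : ℤ → Submodule K V}

theorem iSup_eq_top (A : DGAlgebra P p q 𝒱) : ⨆ k, 𝒱 k = ⊤ :=
  ((DirectSum.isInternal_submodule_iff_iSupIndep_and_iSup_eq_top 𝒱).1 A.isInternal).2

/-- The operator applied to the `i`-th argument when all arguments but the first one are
differentiated. -/
def diffTail (A : DGAlgebra P p q 𝒱) {n : ℕ} (i : Fin n) : V →ₗ[K] V :=
  if (i : ℕ) = 0 then LinearMap.id else A.d

theorem diffTail_of_eq (A : DGAlgebra P p q 𝒱) {n : ℕ} {i : Fin n} (h : (i : ℕ) = 0) (x : V) :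
    A.diffTail i x = x := by
  simp [diffTail, h]

theorem diffTail_of_ne (A : DGAlgebra P p q 𝒱) {n : ℕ} {i : Fin n} (h : (i : ℕ) ≠ 0) (x : V) :
    A.diffTail i x = A.d x := by
  simp [diffTail, h]

@[simp]
theorem diffTail_zero (A : DGAlgebra P p q 𝒱) {m : ℕ} (x : V) :
    A.diffTail (0 : Fin (m + 1)) x = x :=
  A.diffTail_of_eq rfl x

theorem diffTail_two (A : DGAlgebra P p q 𝒱) (x y : V) :
    (fun i => A.diffTail i (![x, y] i)) = ![x, A.d y] := by
  ext i
  fin_cases i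
  · exact A.diffTail_of_eq rfl x
  · exact A.diffTail_of_ne one_ne_zero y

theorem d_diffTail_of_ne (A : DGAlgebra P p q 𝒱) {n : ℕ} {i : Fin n} (h : (i : ℕ) ≠ 0) (x : V) :
    A.d (A.diffTail i x) = 0 := by
  rw [A.diffTail_of_ne h, A.d_d]

theorem diffTail_mem (A : DGAlgebra P p q 𝒱) {n : ℕ} (i : Fin n) {k : ℤ} {x : V} (hx : x ∈ 𝒱 k) :
    A.diffTail i x ∈ 𝒱 (if (i : ℕ) = 0 then k else k + q) := by
  split_ifs with h
  · rwa [A.diffTail_of_eq h]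
  · rw [A.diffTail_of_ne h]
    exact A.d_mem k x hx

/-- `d f(x₀, dx₁, …, dxₘ) = f(dx₀, dx₁, …, dxₘ)`, without sign. -/
theorem d_op_diffTail (A : DGAlgebra P p q 𝒱) {m : ℕ} (a : P.obj (m + 1)) (x : Fin (m + 1) → V) :
    A.d (A.op a fun i => A.diffTail i (x i)) = A.op a fun i => A.d (x i) := by
  suffices h : A.d.compMultilinearMap ((A.op a).compLinearMap fun i => A.diffTail i) =
      (A.op a).compLinearMap fun _ => A.d from congrArg (fun M => M x) h
  refine MultilinearMap.ext_of_homogeneous A.iSup_eq_top fun k y hy => ?_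
  change A.d (A.op a fun i => A.diffTail i (y i)) = A.op a fun i => A.d (y i)
  -- by `d² = 0` only the term at the first argument survives, and it carries no sign
  rw [A.d_op a _ _ fun i => A.diffTail_mem i (hy i), Finset.sum_eq_single 0]
  · simp only [not_lt_zero, Finset.filter_false, Finset.sum_empty, Int.negOnePow_zero, one_smul]
    congr 1
    ext i
    rcases eq_or_ne i 0 with rfl | hi
    · simp
    · rw [Function.update_of_ne hi, A.diffTail_of_ne (Fin.val_ne_zero_iff.2 hi)]
  · intro i _ hi
    rw [A.d_diffTail_of_ne (Fin.val_ne_zero_iff.2 hi), (A.op a).map_update_zero, smul_zero]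
  · simp

/-- `d [x, y] = [dx, y] + [γ x, dy]` where `γ` is the sign by the degree. -/
theorem d_op_two (A : DGAlgebra P p q 𝒱) (a : P.obj 2) (x y : V) :
    A.d (A.op a ![x, y]) =
      A.op a ![A.d x, y] + A.op a ![gradeInvolution A.isInternal x, A.d y] := by
  suffices h : A.d.compMultilinearMap (A.op a) =
      (A.op a).compLinearMap ![A.d, LinearMap.id] +
        (A.op a).compLinearMap ![gradeInvolution A.isInternal, A.d] by
    have := congrArg (fun M => M ![x, y]) h
    simp only [LinearMap.compMultilinearMap_apply, add_apply,
      MultilinearMap.compLinearMap_apply] at this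
    rw [this]
    congr 2 <;> ext i <;> fin_cases i <;> rfl
  refine MultilinearMap.ext_of_homogeneous A.iSup_eq_top fun k y hy => ?_
  rw [LinearMap.compMultilinearMap_apply, A.d_op a k y hy, Fin.sum_univ_two]
  simp only [add_apply, MultilinearMap.compLinearMap_apply]
  congr 1
  · simp only [not_lt_zero, Finset.filter_false, Finset.sum_empty, Int.negOnePow_zero, one_smul]
    congr 1
    ext i
    fin_cases i <;> simp
  · have hf : ({j | j < 1} : Finset (Fin 2)) = {0} := by decide
    rw [hf, Finset.sum_singleton]
    have h0 : (fun i => (![gradeInvolution A.isInternal, A.d] i) (y i)) =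
        Function.update (Function.update y 1 (A.d (y 1))) 0 ((k 0).negOnePow • y 0) := by
      ext i
      fin_cases i
      · simp [gradeInvolution_apply A.isInternal (hy 0)]
      · simp
    have h1 : Function.update (Function.update y 1 (A.d (y 1))) 0 (y 0) =
        Function.update y 1 (A.d (y 1)) := by
      ext i
      fin_cases i <;> simp
    rw [h0]
    rcases Int.units_eq_one_or (k 0).negOnePow with h | h <;> rw [h]
    · rw [one_smul, one_smul, h1]
    · rw [Units.neg_smul, Units.neg_smul, one_smul, one_smul, (A.op a).map_update_neg, h1]

/-- If `f` vanishes on `(x₀, dx₁, …, xⱼ, …, dxₘ)`, then its values with `xⱼ`, respectively `x₀`, as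
the only undifferentiated argument differ by the sign of moving an odd operator past
`dx₀, …, dxⱼ₋₁`. -/
theorem op_undiff_eq (A : DGAlgebra P p q 𝒱) (hq : Odd q) {m : ℕ} (a : P.obj (m + 1))
    (k : Fin (m + 1) → ℤ) (x : Fin (m + 1) → V) (hx : ∀ i, x i ∈ 𝒱 (k i)) (j : Fin (m + 1))
    (h : j ≠ 0 → A.op a (fun i => if i = 0 ∨ i = j then x i else A.d (x i)) = 0) :
    A.op a (fun i => if i = j then x i else A.d (x i)) =
      (∑ i with i < j, (k i + q)).negOnePow • A.op a (fun i => A.diffTail i (x i)) := by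
  rcases eq_or_ne j 0 with rfl | hj
  · simp only [not_lt_zero, Finset.filter_false, Finset.sum_empty, Int.negOnePow_zero, one_smul]
    congr 1
    ext i
    split_ifs with hi
    · rw [A.diffTail_of_eq (by simp [hi])]
    · rw [A.diffTail_of_ne (Fin.val_ne_zero_iff.2 hi)]
  have hX : ∀ i, (if i = 0 ∨ i = j then x i else A.d (x i)) ∈
      𝒱 (if i = 0 ∨ i = j then k i else k i + q) := fun i => by
    split_ifs
    · exact hx i
    · exact A.d_mem _ _ (hx i)
  -- `d` applied to the vanishing value: by `d² = 0` only the terms at `0` and `j` survive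
  have hd := A.d_op a _ _ hX
  rw [h hj, map_zero, Fintype.sum_eq_add 0 j hj.symm] at hd
  · have hj0 : (0 : Fin (m + 1)) ∈ ({i | i < j} : Finset (Fin (m + 1))) := by
      simpa using Fin.pos_of_ne_zero hj
    have hsum : (∑ i with i < j, if i = 0 ∨ i = j then k i else k i + q) =
        (∑ i with i < j, (k i + q)) - q := by
      rw [← Finset.add_sum_erase _ _ hj0, ← Finset.add_sum_erase _ (fun i => k i + q) hj0,
        Finset.sum_congr rfl (g := fun i => k i + q)]
      · simp only [true_or, if_true]
        ring
      · intro i hi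
        simp only [Finset.mem_erase, Finset.mem_filter] at hi
        rw [if_neg (by simp [hi.1, hi.2.2.ne])]
    have h₁ : Function.update (fun i => if i = 0 ∨ i = j then x i else A.d (x i)) 0
        (A.d (if (0 : Fin (m + 1)) = 0 ∨ 0 = j then x 0 else A.d (x 0))) =
        fun i => if i = j then x i else A.d (x i) := by
      ext i
      rcases eq_or_ne i 0 with rfl | hi
      · simp [hj.symm]
      · simp [hi]
    have h₂ : Function.update (fun i => if i = 0 ∨ i = j then x i else A.d (x i)) j
        (A.d (if j = 0 ∨ j = j then x j else A.d (x j))) = fun i => A.diffTail i (x i) := by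
      ext i
      rcases eq_or_ne i j with rfl | hi
      · simp [A.diffTail_of_ne (Fin.val_ne_zero_iff.2 hj)]
      · rcases eq_or_ne i 0 with rfl | hi0
        · simp [hi]
        · simp [hi, hi0, A.diffTail_of_ne (Fin.val_ne_zero_iff.2 hi0)]
    rw [h₁, h₂, hsum, Int.negOnePow_sub, Int.negOnePow_odd q hq, mul_neg_one,
      Units.neg_smul] at hd
    simp only [not_lt_zero, Finset.filter_false, Finset.sum_empty, Int.negOnePow_zero,
      one_smul] at hd
    rw [← sub_eq_add_neg, eq_comm, sub_eq_zero] at hd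
    exact hd
  · rintro i ⟨hi0, hij⟩
    simp only [hi0, hij, or_self, if_false, A.d_d, (A.op a).map_update_zero, smul_zero]

/-! ### Weights of arguments from a trivial subalgebra -/

/-- The subspaces `dA'`, `A'`, `0`, `0`, … of weights `0`, `1`, `2`, `3`, …. -/
def weightSubspace (A : DGAlgebra P p q 𝒱) (A' : Submodule K V) : ℕ → Submodule K V
  | 0 => A'.map A.d
  | 1 => A'
  | _ + 2 => ⊥

theorem weightSubspace_le_iSup (A : DGAlgebra P p q 𝒱) {A' : Submodule K V}
    (hgr : IsGradedSubspace 𝒱 A') (w : ℕ) :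
    A.weightSubspace A' w ≤ ⨆ k, A.weightSubspace A' w ⊓ 𝒱 k := by
  match w with
  | 0 =>
    conv_lhs => rw [weightSubspace, hgr, Submodule.map_iSup]
    refine iSup_le fun k => le_iSup_of_le (k + q) (le_inf ?_ ?_)
    · exact Submodule.map_mono inf_le_left
    · rintro _ ⟨x, hx, rfl⟩
      exact A.d_mem k x hx.2
  | 1 => exact hgr.le
  | w + 2 => exact bot_le

end SymOperad.DGAlgebra

namespace SymOperad

variable {K : Type*} [Field K] {E : Type*} [AddCommGroup E] [Module K E]
  {ρ : Representation K (Equiv.Perm (Fin 2)) E} {R : Submodule K ((freeOperad ρ).obj 3)}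
  {p q : ℤ} {V : Type*} [AddCommGroup V] [Module K V] {𝒱 : ℤ → Submodule K V}

namespace DGAlgebra

/-- Operations add weights: with all arguments in `dA'` an operation takes values in `dA'`, with one
argument in `A'` and the others in `dA'` it takes values in `A'`, and with two or more arguments in
`A'` and the others in `dA'` it vanishes. This holds for the generators by assumption and is
stable under composition. -/
theorem op_mem_weightSubspace (A : DGAlgebra (binaryQuadratic ρ R) p q 𝒱) {A' : Submodule K V}
    (hgr : IsGradedSubspace 𝒱 A')
    (htriv : ∀ e, ∀ x ∈ A', ∀ y ∈ A', A.op (binaryQuadraticGen ρ R e) ![x, y] = 0)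
    (hleft : ∀ e, ∀ x ∈ A', ∀ y ∈ A', A.op (binaryQuadraticGen ρ R e) ![A.d x, y] ∈ A')
    (hright : ∀ e, ∀ x ∈ A', ∀ y ∈ A', A.op (binaryQuadraticGen ρ R e) ![x, A.d y] ∈ A')
    {n : ℕ} (a : (binaryQuadratic ρ R).obj n) (w : Fin n → ℕ) (y : Fin n → V)
    (hy : ∀ i, y i ∈ A.weightSubspace A' (w i)) :
    A.op a y ∈ A.weightSubspace A' (∑ i, w i) := by
  induction a using binaryQuadratic_induction with
  | gen e =>
    have h₀ := hy 0
    have h₁ := hy 1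
    have hy₂ : y = ![y 0, y 1] := by ext i; fin_cases i <;> rfl
    rw [Fin.sum_univ_two, hy₂]
    generalize y 0 = x₀, y 1 = x₁, w 0 = w₀, w 1 = w₁ at h₀ h₁ ⊢
    match w₀, w₁ with
    | 0, 0 =>
      obtain ⟨x, hx, rfl⟩ := h₀
      obtain ⟨z, hz, rfl⟩ := h₁
      refine ⟨_, hright e x hx z hz, ?_⟩
      rw [← A.diffTail_two, A.d_op_diffTail]
      congr 1
      ext i
      fin_cases i <;> rfl
    | 0, 1 =>
      obtain ⟨x, hx, rfl⟩ := h₀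
      exact hleft e x hx x₁ h₁
    | 1, 0 =>
      obtain ⟨z, hz, rfl⟩ := h₁
      exact hright e x₀ h₀ z hz
    | 1, 1 => exact htriv e x₀ h₀ x₁ h₁
    | w₀ + 2, w₁ =>
      rw [(A.op _).map_coord_zero 0 (by simpa using (Submodule.mem_bot K).1 h₀)]
      exact Submodule.zero_mem _
    | w₀, w₁ + 2 =>
      rw [(A.op _).map_coord_zero 1 (by simpa using (Submodule.mem_bot K).1 h₁)]
      exact Submodule.zero_mem _
  | one => simpa [A.op_one] using hy 0
  | act σ a ih =>
    -- the symmetric group action is explicit on homogeneous arguments only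
    refine (A.op _).mem_of_homogeneous (𝒱 := 𝒱) (fun i => A.weightSubspace A' (w i)) _
      (fun i => A.weightSubspace_le_iSup hgr _) (fun k y hy hk => ?_) y hy
    rw [A.op_act σ a k y hk, ← Equiv.sum_comp σ⁻¹ w, Units.smul_def]
    exact zsmul_mem (ih (fun i => w (σ⁻¹ i)) _ fun i => hy (σ⁻¹ i)) _
  | @comp m n r h i a b iha ihb =>
    rw [A.op_comp]
    -- the value of the inner operation enters the outer one with the total weight of its block
    have hsum : ∑ l, w l = ∑ s, if hs : s = i then
        ∑ l, w ((graftEquiv h i).symm (Sum.inr l))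
        else w ((graftEquiv h i).symm (Sum.inl ⟨s, hs⟩)) := by
      rw [← Equiv.sum_comp (graftEquiv h i).symm, Fintype.sum_sum_type, add_comm,
        Fintype.sum_eq_add_sum_subtype_ne _ i, dif_pos rfl]
      exact congrArg _ (Fintype.sum_congr _ _ fun s => by rw [dif_neg s.2])
    rw [hsum]
    refine iha _ _ fun s => ?_
    unfold graftArgs
    split_ifs with hs
    · exact ihb _ _ fun l => hy _
    · exact hy _
  | zero => simp
  | add a b iha ihb =>
    rw [map_add]
    exact Submodule.add_mem _ (iha w y hy) (ihb w y hy)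
  | smul c a ih =>
    rw [map_smul]
    exact Submodule.smul_mem _ _ (ih w y hy)

end DGAlgebra

end SymOperad

/-! ### The algebra structure on the suspension -/

section Desusp

variable {K : Type*} [Field K] {V : Type*} [AddCommGroup V] [Module K V]

/-- The map `sW → V`, `sx ↦ x`. -/
def desusp (W : Submodule K V) : suspSubspace W →ₗ[K] V :=
  (susp K V).symm.toLinearMap ∘ₗ (suspSubspace W).subtype

theorem desusp_injective (W : Submodule K V) : Function.Injective (desusp W) :=
  (susp K V).symm.injective.comp Subtype.val_injective

theorem desusp_mem {W : Submodule K V} (x : suspSubspace W) : desusp W x ∈ W := by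
  obtain ⟨_, y, hy, rfl⟩ := x
  exact hy

theorem mem_subGrading_suspGrading {𝒱 : ℤ → Submodule K V} {W : Submodule K V} {k : ℤ}
    {x : suspSubspace W} :
    x ∈ subGrading (suspGrading 𝒱) (suspSubspace W) k ↔ desusp W x ∈ 𝒱 (k - 1) := by
  constructor
  · rintro ⟨y, hy, hxy⟩
    have : desusp W x = y := congrArg (susp K V).symm hxy.symm
    rwa [this]
  · exact fun h => ⟨_, h, rfl⟩

end Desusp

namespace SymOperad.DGAlgebra

variable {K : Type*} [Field K] {P : SymOperad K} {p q : ℤ} {V : Type*} [AddCommGroup V]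
  [Module K V] {𝒱 : ℤ → Submodule K V}

/-- The operation `(sx₀, …, sxₘ) ↦ s f(x₀, dx₁, …, dxₘ)` on `sA'`. -/
def suspOp (A : DGAlgebra P p q 𝒱) (A' : Submodule K V)
    (hmem : ∀ {n : ℕ} (a : P.obj n) (x : Fin n → V), (∀ i, x i ∈ A') →
      A.op a (fun i => A.diffTail i (x i)) ∈ A') {n : ℕ} :
    P.obj n →ₗ[K] MultilinearMap K (fun _ : Fin n => suspSubspace A') (suspSubspace A') where
  toFun a := ((susp K V).toLinearMap.compMultilinearMap
    ((A.op a).compLinearMap fun i => A.diffTail i ∘ₗ desusp A')).codRestrict (suspSubspace A')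
      fun x => Submodule.mem_map_of_mem (hmem a _ fun i => desusp_mem (x i))
  map_add' a b := MultilinearMap.ext fun x => desusp_injective A' <| by
    change A.op (a + b) _ = A.op a _ + A.op b _
    rw [map_add]
    rfl
  map_smul' c a := MultilinearMap.ext fun x => desusp_injective A' <| by
    change A.op (c • a) _ = c • A.op a _
    rw [map_smul]
    rfl

theorem desusp_suspOp (A : DGAlgebra P p q 𝒱) (A' : Submodule K V)
    (hmem : ∀ {n : ℕ} (a : P.obj n) (x : Fin n → V), (∀ i, x i ∈ A') →
      A.op a (fun i => A.diffTail i (x i)) ∈ A') {n : ℕ} (a : P.obj n)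
    (x : Fin n → suspSubspace A') :
    desusp A' (A.suspOp A' hmem a x) = A.op a fun i => A.diffTail i (desusp A' (x i)) := rfl

/-- The outer arguments of a grafted operation are differentiated according to the slots they
occupy, and the value of the inner operation as a whole according to its own slot. -/
theorem graftArgs_diffTail (A : DGAlgebra P p q 𝒱) {m n r : ℕ} (h : r + 1 = m + (n + 1))
    (i : Fin m) (b : P.obj (n + 1)) (x : Fin r → V) :
    graftArgs h i (A.op b) (fun l => A.diffTail l (x l)) = fun s =>
      A.diffTail s (graftArgs h i (fun y => A.op b fun l => A.diffTail l (y l)) x s) := by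
  ext s
  unfold graftArgs
  split_ifs with hs
  · subst hs
    by_cases hs₀ : (s : ℕ) = 0
    · rw [A.diffTail_of_eq hs₀]
      congr 1
      ext l
      dsimp only
      by_cases hl : (l : ℕ) = 0
      · rw [A.diffTail_of_eq hl, A.diffTail_of_eq]
        simp [graftEquiv, hs₀, hl]
      · rw [A.diffTail_of_ne hl, A.diffTail_of_ne]
        simp [graftEquiv, hl]
    · rw [A.diffTail_of_ne hs₀, A.d_op_diffTail]
      congr 1
      ext l
      dsimp only
      rw [A.diffTail_of_ne]
      simp [graftEquiv, hs₀]
  · have hne : (s : ℕ) ≠ i := fun e => hs (Fin.ext e)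
    dsimp only
    by_cases hs₀ : (s : ℕ) = 0
    · rw [A.diffTail_of_eq hs₀, A.diffTail_of_eq]
      have hsi : s < i := by rw [Fin.lt_def]; omega
      simpa [graftEquiv, hsi] using hs₀
    · rw [A.diffTail_of_ne hs₀, A.diffTail_of_ne]
      by_cases hsi : s < i
      · simpa [graftEquiv, hsi] using hs₀
      · have hsi' : ¬ (s : ℕ) < i := hsi
        simp [graftEquiv, hsi]
        omega

/-- A permutation of the arguments moves the undifferentiated argument away from the first place;
moving it back accounts for the difference between the Koszul signs in `A` and in `sA'`. -/
theorem op_act_diffTail (A : DGAlgebra P p q 𝒱) (hq : Odd q) {A' : Submodule K V}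
    (hvan : ∀ {n : ℕ} (a : P.obj n) (i j : Fin n), i ≠ j → ∀ x : Fin n → V, (∀ l, x l ∈ A') →
      A.op a (fun l => if l = i ∨ l = j then x l else A.d (x l)) = 0)
    {n : ℕ} (σ : Equiv.Perm (Fin n)) (a : P.obj n) (k : Fin n → ℤ) (x : Fin n → V)
    (hx : ∀ i, x i ∈ A') (hk : ∀ i, x i ∈ 𝒱 (k i - 1)) :
    A.op (P.act σ a) (fun i => A.diffTail i (x i)) =
      koszulSign σ k • A.op a (fun i => A.diffTail i (x (σ⁻¹ i))) := by
  match n with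
  | 0 =>
    rw [A.op_act σ a k _ fun i => i.elim0]
    congr 2
    ext i
    exact i.elim0
  | m + 1 =>
    -- after the permutation the undifferentiated argument sits in slot `σ 0`
    have hfun : (fun i => A.diffTail (σ⁻¹ i) (x (σ⁻¹ i))) =
        fun i => if i = σ 0 then x (σ⁻¹ i) else A.d (x (σ⁻¹ i)) := by
      ext i
      split_ifs with hi
      · rw [A.diffTail_of_eq]
        simp [hi]
      · rw [A.diffTail_of_ne]
        rw [Fin.val_ne_zero_iff]
        rintro h
        exact hi (by simp [← h])
    have hreindex : ∑ i with i < σ 0, (k (σ⁻¹ i) - 1 + q) =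
        ∑ i with σ i < σ 0, (k i - 1 + q) := by
      rw [Finset.sum_filter, Finset.sum_filter, ← Equiv.sum_comp σ]
      simp
    have hparity : (∑ i with σ i < σ 0, (k i - 1 + q)).negOnePow =
        (∑ i with σ i < σ 0, k i).negOnePow := by
      rw [Int.negOnePow_eq_iff, ← Finset.sum_sub_distrib]
      refine Finset.even_sum _ fun i _ => ?_
      obtain ⟨t, rfl⟩ := hq
      exact ⟨t, by ring⟩
    rw [A.op_act σ a _ _ fun i => A.diffTail_mem i (hk i), hfun,
      A.op_undiff_eq hq a (fun i => k (σ⁻¹ i) - 1) (fun i => x (σ⁻¹ i)) (fun i => hk _) (σ 0)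
        fun h => hvan a 0 (σ 0) h.symm _ fun i => hx _,
      smul_smul, hreindex, hparity, koszulSign_of_parity σ (b := k), mul_assoc, Int.units_mul_self,
      mul_one]
    · simp
    · intro i hi
      rw [if_neg (Fin.val_ne_zero_iff.2 hi)]
      obtain ⟨t, rfl⟩ := hq
      exact ⟨t, by ring⟩

/-- If `f(x₀, dx₁, …, dxₘ) ∈ A'` and `f(dx₀, …, xᵢ, …, xⱼ, …, dxₘ) = 0` for all operations `f` and
all arguments from `A'`, then the operations `s f(x₀, dx₁, …, dxₘ)` make `sA'` an algebra. -/
def suspAlgebra (A : DGAlgebra P p q 𝒱) (hq : Odd q) (A' : Submodule K V)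
    (hgr : IsGradedSubspace 𝒱 A') (hP : ∀ a : P.obj 0, a = 0)
    (hmem : ∀ {n : ℕ} (a : P.obj n) (x : Fin n → V), (∀ i, x i ∈ A') →
      A.op a (fun i => A.diffTail i (x i)) ∈ A')
    (hvan : ∀ {n : ℕ} (a : P.obj n) (i j : Fin n), i ≠ j → ∀ x : Fin n → V, (∀ l, x l ∈ A') →
      A.op a (fun l => if l = i ∨ l = j then x l else A.d (x l)) = 0) :
    GradedAlgebra P (p + q - 1) (subGrading (suspGrading 𝒱) (suspSubspace A')) where
  isInternal := A.isInternal.suspGrading.subGrading hgr.suspSubspace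
  op := A.suspOp A' hmem
  op_mem {n} a k x hx := by
    simp only [mem_subGrading_suspGrading] at hx ⊢
    rw [desusp_suspOp]
    match n with
    | 0 => rw [hP a, map_zero, zero_apply]; exact Submodule.zero_mem _
    | m + 1 =>
      convert A.op_mem a _ _ fun i => A.diffTail_mem i (hx i) using 2
      simp only [Fin.sum_univ_succ, Fin.val_zero, if_true, Fin.val_succ, Nat.succ_ne_zero, if_false,
        Nat.cast_succ, Finset.sum_add_distrib, Finset.sum_sub_distrib, Finset.sum_const,
        Finset.card_univ, Fintype.card_fin, nsmul_eq_mul]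
      ring
  op_one x := desusp_injective A' (by rw [desusp_suspOp, A.op_one, diffTail_zero])
  op_comp {m n r} h i a b x := by
    match n with
    -- grafting a nullary operation could leave a first argument that was not first before; there
    -- are none
    | 0 =>
      rw [hP b, map_zero, map_zero, map_zero]
      refine ((A.suspOp A' hmem a).map_coord_zero i ?_).symm
      simp [graftArgs]
    | n + 1 =>
      refine desusp_injective A' ?_
      rw [desusp_suspOp, desusp_suspOp, A.op_comp, A.graftArgs_diffTail]
      congr 1
      ext s
      congr 1
      unfold graftArgs
      split_ifs <;> rfl
  op_act σ a k x hx := by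
    simp only [mem_subGrading_suspGrading] at hx
    refine desusp_injective A' ?_
    rw [Units.smul_def, map_zsmul, ← Units.smul_def]
    exact A.op_act_diffTail hq hvan σ a k _ (fun i => desusp_mem _) hx

end SymOperad.DGAlgebra

theorem mainTheorem2 {K : Type*} [Field K] [CharZero K]
    {E : Type*} [AddCommGroup E] [Module K E]
    (ρ : Representation K (Equiv.Perm (Fin 2)) E)
    (R : Submodule K ((freeOperad ρ).obj 3)) (hR : SymOperad.IsQuadraticRelation ρ R)
    (p q : ℤ) (hp : Even p) (hq : Odd q)
    {V : Type*} [AddCommGroup V] [Module K V] (𝒱 : ℤ → Submodule K V)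
    (A : SymOperad.DGAlgebra (SymOperad.binaryQuadratic ρ R) p q 𝒱)
    (A' : Submodule K V) (hgr : IsGradedSubspace 𝒱 A')
    (htriv : ∀ e : E, ∀ x ∈ A', ∀ y ∈ A',
      A.op (SymOperad.binaryQuadraticGen ρ R e) ![x, y] = 0)
    (hleft : ∀ e : E, ∀ a ∈ suspSubspace A', ∀ b ∈ suspSubspace A',
      A.derivedLeft (SymOperad.binaryQuadraticGen ρ R e) a b ∈ suspSubspace A')
    (hright : ∀ e : E, ∀ a ∈ suspSubspace A', ∀ b ∈ suspSubspace A',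
      A.derivedRight (SymOperad.binaryQuadraticGen ρ R e) a b ∈ suspSubspace A') :
    ∃ B : SymOperad.GradedAlgebra (SymOperad.binaryQuadratic ρ R) (p + q - 1)
        (subGrading (suspGrading 𝒱) (suspSubspace A')),
      ∀ (e : E) (a b : suspSubspace A'),
        (B.op (SymOperad.binaryQuadraticGen ρ R e) ![a, b] : Suspension V) =
            A.derivedLeft (SymOperad.binaryQuadraticGen ρ R e) a b ∧
          (B.op (SymOperad.binaryQuadraticGen ρ R e) ![a, b] : Suspension V) =
            A.derivedRight (SymOperad.binaryQuadraticGen ρ R e) a b := by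
  have hγ : ∀ x ∈ A', gradeInvolution A.isInternal x ∈ A' :=
    fun x hx => A.isInternal.gradeInvolution_mem hgr hx
  -- both derived brackets are `[x, dy]`, because `d` is a derivation and `[γ x, y] = 0`
  have hneg : ∀ e, ∀ x ∈ A', ∀ y ∈ A', -A.op (SymOperad.binaryQuadraticGen ρ R e)
      ![A.d (gradeInvolution A.isInternal x), y] =
        A.op (SymOperad.binaryQuadraticGen ρ R e) ![x, A.d y] := by
    intro e x hx y hy
    have := A.d_op_two (SymOperad.binaryQuadraticGen ρ R e) (gradeInvolution A.isInternal x) y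
    rw [htriv e _ (hγ x hx) y hy, map_zero, gradeInvolution_gradeInvolution] at this
    exact neg_eq_of_add_eq_zero_right this.symm
  have hr : ∀ e, ∀ x ∈ A', ∀ y ∈ A',
      A.op (SymOperad.binaryQuadraticGen ρ R e) ![x, A.d y] ∈ A' := by
    intro e x hx y hy
    obtain ⟨z, hz, hz'⟩ := hright e _ (Submodule.mem_map_of_mem hx) _ (Submodule.mem_map_of_mem hy)
    exact (susp K V).injective hz' ▸ hz
  have hl : ∀ e, ∀ x ∈ A', ∀ y ∈ A',
      A.op (SymOperad.binaryQuadraticGen ρ R e) ![A.d x, y] ∈ A' := by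
    intro e x hx y hy
    have := hr e _ (hγ x hx) y hy
    rwa [← hneg e _ (hγ x hx) y hy, gradeInvolution_gradeInvolution, neg_mem_iff] at this
  -- one, respectively two, undifferentiated arguments give total weight one, respectively two
  have hw : ∀ {n : ℕ} (a : (SymOperad.binaryQuadratic ρ R).obj n) (w : Fin n → ℕ) (y : Fin n → V),
      (∀ i, y i ∈ A.weightSubspace A' (w i)) → A.op a y ∈ A.weightSubspace A' (∑ i, w i) :=
    A.op_mem_weightSubspace hgr htriv hl hr
  have hmem : ∀ {n : ℕ} (a : (SymOperad.binaryQuadratic ρ R).obj n) (x : Fin n → V),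
      (∀ i, x i ∈ A') → A.op a (fun i => A.diffTail i (x i)) ∈ A' := by
    intro n a x hx
    match n with
    | 0 => simp [SymOperad.binaryQuadratic_arity_zero a]
    | m + 1 =>
      have := hw a (fun i => if i = 0 then 1 else 0) (fun i => A.diffTail i (x i)) fun i => by
        split_ifs with hi
        · subst hi
          rw [A.diffTail_zero]
          exact hx 0
        · rw [A.diffTail_of_ne (Fin.val_ne_zero_iff.2 hi)]
          exact Submodule.mem_map_of_mem (hx i)
      rwa [Finset.sum_ite_eq' Finset.univ, if_pos (Finset.mem_univ _)] at this
  have hvan : ∀ {n : ℕ} (a : (SymOperad.binaryQuadratic ρ R).obj n) (i j : Fin n), i ≠ j →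
      ∀ x : Fin n → V, (∀ l, x l ∈ A') →
        A.op a (fun l => if l = i ∨ l = j then x l else A.d (x l)) = 0 := by
    intro n a i j hij x hx
    have := hw a (fun l => if l = i ∨ l = j then 1 else 0)
      (fun l => if l = i ∨ l = j then x l else A.d (x l)) fun l => by
        split_ifs
        · exact hx l
        · exact Submodule.mem_map_of_mem (hx l)
    have hcard : ∑ l, (if l = i ∨ l = j then 1 else 0) = 2 := by
      rw [Finset.sum_boole, Finset.filter_or, Finset.filter_eq', Finset.filter_eq']
      simp [hij]
    rw [hcard] at this
    exact (Submodule.mem_bot K).1 this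
  refine ⟨A.suspAlgebra hq A' hgr SymOperad.binaryQuadratic_arity_zero hmem hvan, fun e a b => ?_⟩
  have hB : ((A.suspAlgebra hq A' hgr SymOperad.binaryQuadratic_arity_zero hmem hvan).op
      (SymOperad.binaryQuadraticGen ρ R e) ![a, b] : Suspension V) =
        A.derivedRight (SymOperad.binaryQuadraticGen ρ R e) a b := by
    refine congrArg (susp K V) ?_
    rw [← A.diffTail_two]
    refine congrArg (A.op _) (funext fun i => ?_)
    fin_cases i <;> rfl
  refine ⟨hB.trans ?_, hB⟩
  refine congrArg (susp K V) (hneg e _ (desusp_mem a) _ (desusp_mem b)).symm |>.trans ?_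
  exact map_neg _ _
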